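/- Let $R$ be a commutative Noetherian local ring with residue field $k$, and let $S = R\ltimes k$ be the idealization of $k$, i.e. the commutative ring with underlying additive group $R\oplus k$ and multiplication $(r_1,x_1)(r_2,x_2)=(r_1r_2,\ r_1x_2+r_2x_1)$. Let $M$ and $N$ be finitely generated $S$-modules, and suppose that $N$ is Tor-rigid over $S$: for every finitely generated $S$-module $L$ and every $n\ge 1$, if $\operatorname{Tor}^S_n(N,L)=0$ then $\operatorname{Tor}^S_{n+1}(N,L)=0$. If $\operatorname{Ext}^i_S(M,N)=0$ for some $i>0$ (in particular, if $\operatorname{Ext}^1_S(M,N)=0$), then $M$ is a free $S$-module or $N$ is a free $S$-module. -/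

import Mathlib

open CategoryTheory

universe u

/-- The right action of a local ring `R` on its residue field `k`; as `R` is commutative, it is
`x <• r = (residue class of r) * x`, the same as the left action. Mathlib's square-zero extension
of `R` by a module asks for both actions. -/
noncomputable instance residueFieldOpModule (R : Type u) [CommRing R] [IsLocalRing R] :
    Module Rᵐᵒᵖ (IsLocalRing.ResidueField R) :=
  Module.compHom _ ((IsLocalRing.residue R).fromOpposite fun _ _ => mul_comm _ _)

/-- The two actions of `R` on `k` agree. -/
instance residueFieldIsCentralScalar (R : Type u) [CommRing R] [IsLocalRing R] :
    IsCentralScalar R (IsLocalRing.ResidueField R) where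
  op_smul_eq_smul r x := by
    rw [Algebra.smul_def]
    rfl

/-- The idealization `R ⋉ k` of the residue field `k` of a local ring `R`: the ring on `R × k` with
`(r₁, x₁) * (r₂, x₂) = (r₁ * r₂, r₁ • x₂ + r₂ • x₁)`. -/
abbrev ResidueIdealization (R : Type u) [CommRing R] [IsLocalRing R] : Type u :=
  TrivSqZeroExt R (IsLocalRing.ResidueField R)

/-- A module `N` over a commutative ring `S` is Tor-rigid if, for every finitely generated
`S`-module `L` and every `n ≥ 1`, the vanishing of `Tor_n(N, L)` implies that of `Tor_{n+1}(N, L)`.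
-/
def IsTorRigid (S : Type u) [CommRing S] (N : Type u) [AddCommGroup N] [Module S N] : Prop :=
  ∀ (L : Type u) [AddCommGroup L] [Module S L] [Module.Finite S L] (n : ℕ), 1 ≤ n →
    Subsingleton (((Tor (ModuleCat.{u} S) n).obj (ModuleCat.of S N)).obj (ModuleCat.of S L)) →
    Subsingleton (((Tor (ModuleCat.{u} S) (n + 1)).obj (ModuleCat.of S N)).obj (ModuleCat.of S L))

/-!
Write `S = R ⋉ k`, with maximal ideal `𝔫`, and `x = (0, 1) ∈ S`. The annihilator of `x` is `𝔫`, the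
ideal `xS` is a copy of `k`, and `xS` is a direct summand of every ideal between itself and `𝔫`,
because `(r, t) ↦ (0, t)` is `S`-linear on `𝔫` (`socleProjection`). The same holds for submodules
of free modules, in each coordinate. In particular the kernel `K` of a minimal cover `F → M` lies in
`𝔫F` and is annihilated by `x`; so if `K` is free, then `K = 0` and `M` is free
(`free_of_free_ker`). Since `Ext^{i+1}(M, N) ≅ Ext^i(K, N)` for `i ≥ 1`
(`subsingleton_ext_ker`), only `i = 1` needs an argument, and there one may assume `K ≠ 0`.

Tor-rigidity is used through presentations (`IsTorRigid.injective_lTensor_ker`): for a map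
`d : X → Y` of projective modules, with `Y` finite, if `N ⊗ range d → N ⊗ Y` is injective
(`Tor₁(N, coker d) = 0`), so is `N ⊗ ker d → N ⊗ X` (`Tor₂(N, coker d) = 0`).

Take free modules `F₂ → F₁` presenting `K`, with `F₁ → K` minimal, and let `d : F₁* → F₂*` be the
dual map. The vanishing of `Ext¹(M, N)` says that maps `K → N` extend to `F`, which
gives the injectivity of `N ⊗ range d → N ⊗ F₂*` (`injective_lTensor_range_dualMap`). By rigidity
`N ⊗ ker d → N ⊗ F₁*` is injective. Now `ker d = K*` contains `xF₁*`, as `F₁ → K` is minimal, and it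
is contained in `𝔫F₁*`, as `x` annihilates `K`. So `xS` is a direct summand of `ker d`, and
`N ⊗ xS → N` is injective (`free_of_forall_exists_extension`). Rigidity for multiplication by `x` on
`S`, with image `xS` and kernel `𝔫`, shows that `N ⊗ 𝔫 → N` is injective, and `N` is free
(`free_of_injective_lTensor_socle`).
-/

/-! ### Resolutions with a prescribed beginning -/

section Resolution

open Limits

variable {C : Type*} [Category* C] [Abelian C] [EnoughProjectives C]

namespace CategoryTheory.ProjectiveResolution

variable {X Y : C} (d : X ⟶ Y)

/-- The chain complex `⋯ ⟶ X ⟶ Y` extending `d : X ⟶ Y` to the left by projective objects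
mapping onto the successive kernels. -/
noncomputable def extendComplex : ChainComplex C ℕ :=
  ChainComplex.mk' Y X d fun f =>
    ⟨_, Projective.π (kernel f) ≫ kernel.ι f, by simp⟩

lemma extendComplex_d_one_zero : (extendComplex d).d 1 0 = d := by
  simp [extendComplex]

/-- The objects of `extendComplex d` in degrees at least `2` are the chosen projective
objects mapping onto kernels. -/
noncomputable def extendComplexXIso (n : ℕ) :
    (extendComplex d).X (n + 2) ≅
      Projective.over (kernel ((extendComplex d).d (n + 1) n)) :=
  ChainComplex.mk'XIso _ _ _ _ n

lemma extendComplex_d (n : ℕ) :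
    (extendComplex d).d (n + 2) (n + 1) = (extendComplexXIso d n).hom ≫
      Projective.π (kernel ((extendComplex d).d (n + 1) n)) ≫ kernel.ι _ :=
  ChainComplex.mk'_d _ _ _ _ n

lemma exact_projective_π_comp_kernel_ι {X Y : C} (f : X ⟶ Y) :
    (ShortComplex.mk (Projective.π (kernel f) ≫ kernel.ι f) f (by simp)).Exact := by
  let α : ShortComplex.mk (Projective.π (kernel f) ≫ kernel.ι f) f (by simp) ⟶
      ShortComplex.mk (kernel.ι f) f (by simp) :=
    { τ₁ := Projective.π _
      τ₂ := 𝟙 _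
      τ₃ := 𝟙 _ }
  have : Epi α.τ₁ := inferInstanceAs (Epi (Projective.π _))
  have : IsIso α.τ₂ := inferInstanceAs (IsIso (𝟙 _))
  have : Mono α.τ₃ := inferInstanceAs (Mono (𝟙 _))
  rw [ShortComplex.exact_iff_of_epi_of_isIso_of_mono α]
  exact ShortComplex.exact_of_f_is_kernel _ (kernelIsKernel f)

-- The differentials of `extendComplex d` are only isomorphic, not definitionally equal, to the
-- morphisms of the construction; exactness is transported along `extendComplexXIso`.
lemma extendComplex_exactAt_succ (n : ℕ) : (extendComplex d).ExactAt (n + 1) := by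
  rw [HomologicalComplex.exactAt_iff' _ (n + 1 + 1) (n + 1) n (by simp) (by simp)]
  refine (ShortComplex.exact_iff_of_iso ?_).1
    (exact_projective_π_comp_kernel_ι ((extendComplex d).d (n + 1) n))
  refine ShortComplex.isoMk (extendComplexXIso d n).symm (Iso.refl _) (Iso.refl _) ?_ ?_
  · refine (Iso.inv_comp_eq _).2 ?_
    refine (extendComplex_d d n).trans ?_
    exact congrArg _ (Category.comp_id _).symm
  · exact (Category.id_comp _).trans (Category.comp_id _).symm

lemma projective_extendComplex_X [Projective X] [Projective Y] (n : ℕ) :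
    Projective ((extendComplex d).X n) :=
  match n with
  | 0 => ‹Projective Y›
  | 1 => ‹Projective X›
  | n + 2 => Projective.of_iso (extendComplexXIso d n).symm inferInstance

/-- The augmentation of `extendComplex d` given by a morphism `p` with `d ≫ p = 0`. -/
noncomputable def extendComplexAugmentation {Z : C} (p : Y ⟶ Z) (w : d ≫ p = 0) :
    extendComplex d ⟶ (ChainComplex.single₀ C).obj Z :=
  (ChainComplex.toSingle₀Equiv _ _).symm
    ⟨p, (congrArg (· ≫ p) (extendComplex_d_one_zero d)).trans w⟩

lemma extendComplexAugmentation_f_zero {Z : C} (p : Y ⟶ Z) (w : d ≫ p = 0) :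
    (extendComplexAugmentation d p w).f 0 = p :=
  ChainComplex.toSingle₀Equiv_symm_apply_f_zero _ _

/-- A projective resolution of `Z` that starts with a given presentation
`X ⟶ Y ⟶ Z` by projective objects. -/
noncomputable def ofPresentation [Projective X] [Projective Y] {Z : C} (p : Y ⟶ Z) [Epi p]
    (w : d ≫ p = 0) (h : (ShortComplex.mk d p w).Exact) : ProjectiveResolution Z where
  complex := extendComplex d
  projective := projective_extendComplex_X d
  π := extendComplexAugmentation d p w
  quasiIso := ⟨fun n => by
    cases n with
    | zero =>
      rw [ChainComplex.quasiIsoAt₀_iff, ShortComplex.quasiIso_iff_of_zeros' _ rfl rfl rfl]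
      refine (ShortComplex.exact_and_epi_g_iff_of_iso ?_).2 ⟨h, ‹Epi p›⟩
      refine ShortComplex.isoMk (Iso.refl _) (Iso.refl _) (Iso.refl _) ?_ ?_
      · refine (Category.id_comp _).trans (Eq.trans ?_ (Category.comp_id _).symm)
        exact (extendComplex_d_one_zero d).symm
      · refine (Category.id_comp _).trans (Eq.trans ?_ (Category.comp_id _).symm)
        exact (extendComplexAugmentation_f_zero d p w).symm
    | succ n =>
      rw [quasiIsoAt_iff_exactAt']
      · exact extendComplex_exactAt_succ d n
      · exact ChainComplex.exactAt_succ_single_obj _ n⟩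

end CategoryTheory.ProjectiveResolution

end Resolution

/-! ### Tor-rigidity in terms of presentations -/

section TensorExact

open LinearMap

variable {A : Type*} [CommRing A] {X Y Z : Type*} [AddCommGroup X] [AddCommGroup Y]
  [AddCommGroup Z] [Module A X] [Module A Y] [Module A Z] (N : Type*) [AddCommGroup N] [Module A N]

/-- Exactness of `X → Y → Z` persists after tensoring with `N` exactly when the inclusion of the
image of `Y → Z` stays injective. -/
lemma lTensor_exact_iff_injective_range {f : X →ₗ[A] Y} {g : Y →ₗ[A] Z}
    (h : Function.Exact f g) :
    Function.Exact (f.lTensor N) (g.lTensor N) ↔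
      Function.Injective ((range g).subtype.lTensor N) := by
  have hg : g.lTensor N = (range g).subtype.lTensor N ∘ₗ g.rangeRestrict.lTensor N := by
    rw [← lTensor_comp]; rfl
  have hs : Function.Surjective (g.rangeRestrict.lTensor N) :=
    lTensor_surjective N g.surjective_rangeRestrict
  have he : Function.Exact (f.lTensor N) (g.rangeRestrict.lTensor N) := by
    refine lTensor_exact N (fun y => ?_) g.surjective_rangeRestrict
    rw [← h y, ← Subtype.coe_inj]; rfl
  constructor
  · intro H
    rw [injective_iff_map_eq_zero]
    intro z hz
    obtain ⟨y, rfl⟩ := hs z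
    rw [he y]
    exact (H y).1 (by rw [hg]; exact hz)
  · intro H y
    rw [← he y, hg, LinearMap.comp_apply, map_eq_zero_iff _ H]

end TensorExact

section Rigid

open MonoidalCategory

variable {A : Type u} [CommRing A]

/-- `Tor_{n+1}(N, L)` vanishes exactly when tensoring a projective resolution of `L` with `N` leaves
it exact in degree `n + 1`. -/
lemma subsingleton_tor_iff_exact {N L : ModuleCat.{u} A} (P : ProjectiveResolution L) (n : ℕ) :
    Subsingleton (((Tor (ModuleCat.{u} A) (n + 1)).obj N).obj L) ↔
      Function.Exact ((P.complex.d (n + 2) (n + 1)).hom.lTensor N)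
        ((P.complex.d (n + 1) n).hom.lTensor N) := by
  rw [← ModuleCat.isZero_iff_subsingleton, Tor_obj,
    (P.isoLeftDerivedObj ((tensoringLeft _).obj N) (n + 1)).isZero_iff]
  erw [← HomologicalComplex.exactAt_iff_isZero_homology]
  rw [HomologicalComplex.exactAt_iff' _ (n + 2) (n + 1) n (by simp) (by simp),
    ShortComplex.ShortExact.moduleCat_exact_iff_function_exact]
  rfl

/-- Rigidity on the level of projective presentations: if tensoring with `N` preserves injectivity of
the inclusion `range d ⊆ Y`, that is, `Tor₁(N, Y / range d) = 0`, then it also preserves that of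
the inclusion `ker d ⊆ X`, that is, `Tor₂(N, Y / range d) = 0`. -/
lemma IsTorRigid.injective_lTensor_ker {N : Type u} [AddCommGroup N] [Module A N]
    (hN : IsTorRigid A N) {X Y : Type u} [AddCommGroup X] [AddCommGroup Y] [Module A X]
    [Module A Y] [Module.Projective A X] [Module.Projective A Y] [Module.Finite A Y]
    (d : X →ₗ[A] Y) (h : Function.Injective (d.range.subtype.lTensor N)) :
    Function.Injective (d.ker.subtype.lTensor N) := by
  let e : ModuleCat.of A X ⟶ ModuleCat.of A Y := ModuleCat.ofHom d
  let p : ModuleCat.of A Y ⟶ ModuleCat.of A (Y ⧸ d.range) := ModuleCat.ofHom d.range.mkQ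
  have : Projective (ModuleCat.of A X) :=
    (IsProjective.iff_projective _).1 ‹_›
  have : Projective (ModuleCat.of A Y) :=
    (IsProjective.iff_projective _).1 ‹_›
  have : Epi p := (ModuleCat.epi_iff_surjective _).2 d.range.mkQ_surjective
  have w : e ≫ p = 0 := by
    ext x
    exact (Submodule.Quotient.mk_eq_zero _).2 ⟨x, rfl⟩
  let P := ProjectiveResolution.ofPresentation e p w
    ((ShortComplex.ShortExact.moduleCat_exact_iff_function_exact _).2
      (LinearMap.exact_map_mkQ_range d))
  have hd : (P.complex.d 1 0).hom = d :=
    congrArg ModuleCat.Hom.hom (ProjectiveResolution.extendComplex_d_one_zero e)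
  have hP (n : ℕ) : Function.Exact (P.complex.d (n + 2) (n + 1)).hom
      (P.complex.d (n + 1) n).hom :=
    (ShortComplex.ShortExact.moduleCat_exact_iff_function_exact _).1 (P.exact_succ n)
  have key := hN (Y ⧸ d.range) 1 le_rfl
  rw [subsingleton_tor_iff_exact P 0, subsingleton_tor_iff_exact P 1,
    lTensor_exact_iff_injective_range _ (hP 0), lTensor_exact_iff_injective_range _ (hP 1),
    ← (LinearMap.exact_iff.1 (hP 0))] at key
  change Function.Injective ((LinearMap.range (P.complex.d 1 0).hom).subtype.lTensor N) →
    Function.Injective ((LinearMap.ker (P.complex.d 1 0).hom).subtype.lTensor N) at key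
  rw [hd] at key
  exact key h

end Rigid

/-! ### Minimal covers over a local ring -/

section MinimalCover

open IsLocalRing

/-- A finitely generated module over a local ring is the image of a finite free module under a map
whose kernel consists of vectors with all coordinates in the maximal ideal. -/
lemma IsLocalRing.exists_minimal_cover (A : Type*) [CommRing A] [IsLocalRing A] (M : Type*)
    [AddCommGroup M] [Module A M] [Module.Finite A M] :
    ∃ (n : ℕ) (f : (Fin n → A) →ₗ[A] M), Function.Surjective f ∧
      ∀ v ∈ LinearMap.ker f, ∀ i, v i ∈ maximalIdeal A := by
  classical
  have hex : ∃ n, ∃ g : Fin n → M, Submodule.span A (Set.range g) = ⊤ := Module.Finite.exists_fin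
  obtain ⟨g, hg⟩ := Nat.find_spec hex
  have hmin := fun m => Nat.find_min (H := hex) (m := m)
  generalize Nat.find hex = n at g hg hmin
  refine ⟨n, Fintype.linearCombination A g, ?_, fun v hv i => ?_⟩
  · rw [← LinearMap.range_eq_top, Fintype.range_linearCombination, hg]
  by_contra hi
  rw [mem_maximalIdeal, mem_nonunits_iff, not_not] at hi
  obtain _ | n := n
  · exact i.elim0
  -- A relation with a unit coefficient allows one to drop a generator.
  refine hmin n n.lt_succ_self ⟨g ∘ i.succAbove, ?_⟩
  rw [eq_top_iff, ← hg, Submodule.span_le]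
  have hmem (j : Fin n) : g (i.succAbove j) ∈ Submodule.span A (Set.range (g ∘ i.succAbove)) :=
    Submodule.subset_span ⟨j, rfl⟩
  rintro _ ⟨j, rfl⟩
  rcases Fin.eq_self_or_eq_succAbove i j with rfl | ⟨j, rfl⟩
  · rw [LinearMap.mem_ker, Fintype.linearCombination_apply, Fin.sum_univ_succAbove _ j] at hv
    rw [SetLike.mem_coe, ← Submodule.smul_mem_iff_of_isUnit _ hi, eq_neg_of_add_eq_zero_left hv]
    exact neg_mem (Submodule.sum_mem _ fun k _ => Submodule.smul_mem _ _ (hmem k))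
  · exact hmem j

end MinimalCover

/-! ### Vanishing of Ext and syzygies -/

section Ext

open Abelian

variable {A : Type u} [CommRing A] {F M : Type u} [AddCommGroup F] [AddCommGroup M] [Module A F]
  [Module A M] {f : F →ₗ[A] M} (N : Type u) [AddCommGroup N] [Module A N]

lemma subsingleton_ext_ker [Module.Projective A F] (hf : Function.Surjective f) (n : ℕ)
    (h : Subsingleton (Ext (ModuleCat.of A M) (ModuleCat.of A N) (n + 2))) :
    Subsingleton (Ext (ModuleCat.of A (LinearMap.ker f)) (ModuleCat.of A N) (n + 1)) := by
  have hS := LinearMap.shortExact_shortComplexKer hf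
  have : Projective (ModuleCat.of A F) := (IsProjective.iff_projective _).1 ‹_›
  refine subsingleton_of_forall_eq 0 fun x => ?_
  obtain ⟨y, rfl⟩ := Ext.contravariant_sequence_exact₁ hS _ x (n₁ := n + 2) (by omega)
    (Subsingleton.elim (α := Ext (ModuleCat.of A M) (ModuleCat.of A N) (n + 2)) _ _)
  rw [show y = 0 from Ext.eq_zero_of_projective (P := ModuleCat.of A F) y, Ext.comp_zero]

/-- If `Ext¹(M, N) = 0` then every map to `N` from a submodule with quotient `M` extends. -/
lemma exists_extension_of_subsingleton_ext_one (hf : Function.Surjective f)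
    (h : Subsingleton (Ext (ModuleCat.of A M) (ModuleCat.of A N) 1))
    (φ : LinearMap.ker f →ₗ[A] N) :
    ∃ ψ : F →ₗ[A] N, ψ ∘ₗ (LinearMap.ker f).subtype = φ := by
  have hS := LinearMap.shortExact_shortComplexKer hf
  obtain ⟨y, hy⟩ := Ext.contravariant_sequence_exact₁ hS (ModuleCat.of A N)
    (Ext.mk₀ (ModuleCat.ofHom φ)) (n₁ := 1) rfl
    (Subsingleton.elim (α := Ext (ModuleCat.of A M) (ModuleCat.of A N) 1) _ _)
  obtain ⟨ψ, rfl⟩ := (Ext.mk₀_bijective _ _).2 y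
  rw [Ext.mk₀_comp_mk₀] at hy
  exact ⟨ψ.hom, congrArg ModuleCat.Hom.hom ((Ext.mk₀_bijective _ _).1 hy)⟩

end Ext

/-! ### The idealization of the residue field -/

namespace ResidueIdealization

open IsLocalRing TrivSqZeroExt

variable {R : Type u} [CommRing R] [IsLocalRing R]

instance : IsLocalRing (ResidueIdealization R) :=
  IsLocalRing.of_isUnit_or_isUnit_one_sub_self fun a => by
    simpa [isUnit_iff_isUnit_fst] using IsLocalRing.isUnit_or_isUnit_one_sub_self a.fst

instance [IsNoetherianRing R] : IsNoetherianRing (ResidueIdealization R) :=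
  have : Module.Finite R (ResidueIdealization R) :=
    inferInstanceAs (Module.Finite R (R × ResidueField R))
  IsNoetherianRing.of_finite R _

lemma mem_maximalIdeal_iff {a : ResidueIdealization R} :
    a ∈ maximalIdeal (ResidueIdealization R) ↔ a.fst ∈ maximalIdeal R := by
  simp [isUnit_iff_isUnit_fst]

variable (R) in
/-- The element `(0, 1)`, which generates a copy of the residue field inside `R ⋉ k`. -/
noncomputable abbrev socle : ResidueIdealization R := inr 1

lemma mul_socle_eq_zero_iff {a : ResidueIdealization R} :
    a * socle R = 0 ↔ a ∈ maximalIdeal (ResidueIdealization R) := by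
  rw [mem_maximalIdeal_iff, ← residue_eq_zero_iff, TrivSqZeroExt.ext_iff]
  simp [Algebra.smul_def]

/-- The projection `(r, t) ↦ (0, t)` from the maximal ideal of `R ⋉ k` onto the ideal generated by
`(0, 1)`. It is linear because the first components of elements of the maximal ideal
annihilate `k`. -/
noncomputable def socleProjection :
    maximalIdeal (ResidueIdealization R) →ₗ[ResidueIdealization R]
      Ideal.span {socle R} where
  toFun a := ⟨inr a.1.snd, by
    obtain ⟨r, hr⟩ := residue_surjective a.1.snd
    refine Ideal.mem_span_singleton'.2 ⟨inl r, ?_⟩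
    rw [← hr, inl_mul_inr, Algebra.smul_def, mul_one]
    rfl⟩
  map_add' a b := by ext <;> simp
  map_smul' a b := by
    have hb : residue R b.1.fst = 0 := (residue_eq_zero_iff _).2 (mem_maximalIdeal_iff.1 b.2)
    ext
    · simp
    · simp [Algebra.smul_def, hb]

lemma socleProjection_apply_of_mem_span {a : ResidueIdealization R}
    (ha : a ∈ Ideal.span {socle R}) (ha' : a ∈ maximalIdeal (ResidueIdealization R)) :
    socleProjection ⟨a, ha'⟩ = ⟨a, ha⟩ := by
  obtain ⟨b, rfl⟩ := Ideal.mem_span_singleton'.1 ha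
  ext <;> simp [socleProjection]

end ResidueIdealization

/-! ### Tor-rigid modules over the idealization -/

section DualPresentation

open TensorProduct LinearMap

variable {A : Type*} [CommRing A] {F F₁ F₂ N : Type*} [AddCommGroup F] [AddCommGroup F₁]
  [AddCommGroup F₂] [AddCommGroup N] [Module A F] [Module A F₁] [Module A F₂] [Module A N]

/-- The hypothesis has `N` as the right factor, the side on which `dualTensorHom` compares
`F* ⊗ N` with `Hom(F, N)`. -/
lemma injective_lTensor_range_of_forall (u : F₁ →ₗ[A] F)
    (h : ∀ y : F₁ ⊗[A] N, u.rTensor N y = 0 → u.rangeRestrict.rTensor N y = 0) :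
    Function.Injective ((range u).subtype.lTensor N) := by
  rw [lTensor_inj_iff_rTensor_inj, injective_iff_map_eq_zero]
  intro z hz
  obtain ⟨y, rfl⟩ := rTensor_surjective N u.surjective_rangeRestrict z
  rw [← LinearMap.comp_apply, ← rTensor_comp] at hz
  exact h y hz

/-- Let `F₂ → F₁ → F` be a complex with `F₁` and `F` finite free. If every map `F₁ → N` that
vanishes on `F₂` factors through `F`, then tensoring with `N` keeps the inclusion of the image of
`F₁* → F₂*` injective: an element of the kernel lifts to `N ⊗ F₁* ≅ Hom(F₁, N)` as a map that
vanishes on `F₂`, and therefore comes from `N ⊗ F* ≅ Hom(F, N)`. -/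
lemma injective_lTensor_range_dualMap [Module.Free A F₁] [Module.Finite A F₁] [Module.Free A F]
    [Module.Finite A F] {d : F₂ →ₗ[A] F₁} {e : F₁ →ₗ[A] F}
    (hde : e ∘ₗ d = 0)
    (hext : ∀ φ : F₁ →ₗ[A] N, φ ∘ₗ d = 0 → ∃ ψ : F →ₗ[A] N, ψ ∘ₗ e = φ) :
    Function.Injective ((range d.dualMap).subtype.lTensor N) := by
  refine injective_lTensor_range_of_forall _ fun y hz => ?_
  have hφ : dualTensorHom A F₁ N y ∘ₗ d = 0 := by
    have := LinearMap.congr_fun (dualTensorHom_comp_rTensor_dualMap (P := N) d) y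
    rw [LinearMap.comp_apply, hz, map_zero] at this
    exact this.symm
  obtain ⟨ψ, hψ⟩ := hext _ hφ
  obtain ⟨w, rfl⟩ := (dualTensorHomEquiv A F N).surjective ψ
  have hy : e.dualMap.rTensor N w = y := by
    apply (dualTensorHomEquiv A F₁ N).injective
    have := LinearMap.congr_fun (dualTensorHom_comp_rTensor_dualMap (P := N) e) w
    exact this.trans hψ
  rw [← hy, ← LinearMap.comp_apply, ← rTensor_comp]
  have : d.dualMap.rangeRestrict ∘ₗ e.dualMap = 0 := by
    ext1 x
    apply Subtype.ext
    change d.dualMap (e.dualMap x) = 0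
    rw [← LinearMap.comp_apply, dualMap_comp_dualMap, hde]
    exact LinearMap.ext fun _ => map_zero x
  rw [this, rTensor_zero, LinearMap.zero_apply]

end DualPresentation

namespace ResidueIdealization

open IsLocalRing LinearMap TrivSqZeroExt

variable {R : Type u} [CommRing R] [IsLocalRing R]

/-- A Tor-rigid module `N` is free as soon as `N ⊗ (0, 1)S → N` is injective: this map computes
`Tor₁(N, S / (0, 1)S)`, and `(0, 1)S ≅ k` is the first syzygy of `S / (0, 1)S`, so that
rigidity gives `Tor₁(N, k) = 0`. -/
lemma free_of_injective_lTensor_socle [IsNoetherianRing R] {N : Type u} [AddCommGroup N]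
    [Module (ResidueIdealization R) N] [Module.Finite (ResidueIdealization R) N]
    (hN : IsTorRigid (ResidueIdealization R) N)
    (h : Function.Injective ((Ideal.span {socle R}).subtype.lTensor N)) :
    Module.Free (ResidueIdealization R) N := by
  have := Module.finitePresentation_of_finite (ResidueIdealization R) N
  let d := toSpanSingleton (ResidueIdealization R) (ResidueIdealization R) (socle R)
  have hr : range d = Ideal.span {socle R} := range_toSpanSingleton _
  have hk : ker d = maximalIdeal (ResidueIdealization R) := by
    ext a
    exact mul_socle_eq_zero_iff
  have key := hN.injective_lTensor_ker d
  rw [hr, hk] at key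
  exact Module.free_of_maximalIdeal_rTensor_injective
    ((LinearMap.lTensor_inj_iff_rTensor_inj _ _).1 (key h))

/-- Let `K ⊆ G` be a submodule on which a coordinate `c`, dual to `g`, takes values in the maximal
ideal. If `(0, 1)g ∈ K`, then `(0, 1)S` is a direct summand of `K`, by `socleProjection`; hence
injectivity of `N ⊗ K → N ⊗ G` passes to `N ⊗ (0, 1)S → N ⊗ S`. -/
lemma injective_lTensor_socle_of_injective {N : Type*} [AddCommGroup N]
    [Module (ResidueIdealization R) N] {G : Type*} [AddCommGroup G]
    [Module (ResidueIdealization R) G] {K : Submodule (ResidueIdealization R) G}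
    {g : G} {c : G →ₗ[ResidueIdealization R] ResidueIdealization R} (hg : c g = 1)
    (hgK : socle R • g ∈ K) (hc : ∀ v ∈ K, c v ∈ maximalIdeal (ResidueIdealization R))
    (h : Function.Injective (K.subtype.lTensor N)) :
    Function.Injective ((Ideal.span {socle R}).subtype.lTensor N) := by
  let ι := toSpanSingleton (ResidueIdealization R) G g
  have hι : ∀ a ∈ Ideal.span {socle R}, ι a ∈ K := fun a ha => by
    obtain ⟨b, rfl⟩ := Ideal.mem_span_singleton'.1 ha
    rw [toSpanSingleton_apply, mul_smul]
    exact K.smul_mem b hgK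
  let j : Ideal.span {socle R} →ₗ[ResidueIdealization R] K := ι.restrict hι
  let q : K →ₗ[ResidueIdealization R] Ideal.span {socle R} := socleProjection ∘ₗ c.restrict hc
  have hqj : q ∘ₗ j = .id := by
    ext1 a
    have hca : c (ι a) = a := by simp [ι, hg]
    have ha : (a : ResidueIdealization R) ∈ maximalIdeal _ := hca ▸ hc _ (hι a a.2)
    have : c.restrict hc (j a) = ⟨a, ha⟩ := Subtype.ext hca
    exact (congrArg socleProjection this).trans (socleProjection_apply_of_mem_span a.2 ha)
  have hj : Function.Injective (j.lTensor N) :=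
    Function.LeftInverse.injective (g := q.lTensor N) fun x => by
      rw [← LinearMap.comp_apply, ← lTensor_comp, hqj, lTensor_id, LinearMap.id_apply]
  have hcomp : ι ∘ₗ (Ideal.span {socle R}).subtype = K.subtype ∘ₗ j := rfl
  refine Function.Injective.of_comp (f := ι.lTensor N) ?_
  rw [← coe_comp, ← lTensor_comp, hcomp, lTensor_comp, coe_comp]
  exact h.comp hj

/-- Let `K` be a nonzero submodule of a finite free module `F`, annihilated by `(0, 1)`, and let `N`
be Tor-rigid. If all maps `K → N` extend to `F`, that is, `Ext¹(F / K, N) = 0`, then `N` is free.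

For a finite presentation `F₂ → F₁ → K → 0` with `F₁` minimal, `L = coker (F₁* → F₂*)`
satisfies `Tor₁(N, L) = 0`. By rigidity `Tor₂(N, L) = 0`, so that tensoring with `N` preserves
injectivity of the inclusion of `K* = ker (F₁* → F₂*)` into `F₁*`, and `(0, 1)S` is a direct summand
of `K*`. -/
lemma free_of_forall_exists_extension [IsNoetherianRing R] {N : Type u} [AddCommGroup N]
    [Module (ResidueIdealization R) N] [Module.Finite (ResidueIdealization R) N]
    (hN : IsTorRigid (ResidueIdealization R) N) {F : Type u} [AddCommGroup F]
    [Module (ResidueIdealization R) F] [Module.Free (ResidueIdealization R) F]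
    [Module.Finite (ResidueIdealization R) F] {K : Submodule (ResidueIdealization R) F}
    [Nontrivial K] (hK : ∀ v ∈ K, socle R • v = 0)
    (hext : ∀ φ : K →ₗ[ResidueIdealization R] N,
      ∃ ψ : F →ₗ[ResidueIdealization R] N, ψ ∘ₗ K.subtype = φ) :
    Module.Free (ResidueIdealization R) N := by
  obtain ⟨n, p, hp, hmin⟩ := exists_minimal_cover (ResidueIdealization R) K
  obtain ⟨m, d₀, hd₀⟩ := Module.Finite.exists_fin' (ResidueIdealization R) (ker p)
  let d : (Fin m → ResidueIdealization R) →ₗ[ResidueIdealization R] _ := (ker p).subtype ∘ₗ d₀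
  have hpd : p ∘ₗ d = 0 := by
    ext1 i
    ext1
    exact (d₀ _).2
  have hinj := injective_lTensor_range_dualMap (N := N) (d := d) (e := K.subtype ∘ₗ p)
    (by rw [comp_assoc, hpd, comp_zero]) fun φ hφ => by
      have hle : ker p ≤ ker φ := fun v hv => by
        obtain ⟨w, hw⟩ := hd₀ ⟨v, hv⟩
        have : d w = v := congrArg Subtype.val hw
        rw [mem_ker, ← this]
        exact LinearMap.congr_fun hφ w
      obtain ⟨ψ, hψ⟩ := hext ((ker p).liftQ φ hle ∘ₗ (p.quotKerEquivOfSurjective hp).symm)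
      refine ⟨ψ, ?_⟩
      rw [← comp_assoc, hψ]
      refine LinearMap.ext fun v => ?_
      have hv : (p.quotKerEquivOfSurjective hp).symm (p v) = (ker p).mkQ v :=
        (LinearEquiv.symm_apply_eq _).2 rfl
      change (ker p).liftQ φ hle ((p.quotKerEquivOfSurjective hp).symm (p v)) = φ v
      rw [hv]
      rfl
  have hker := hN.injective_lTensor_ker d.dualMap hinj
  have hn : n ≠ 0 := by
    rintro rfl
    exact not_subsingleton K hp.subsingleton
  let i : Fin n := ⟨0, Nat.pos_of_ne_zero hn⟩
  -- `ker d.dualMap`, the dual of `K`, contains the multiples of `(0, 1)` since `p` is minimal, and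
  -- its elements have coefficients in the maximal ideal since `(0, 1)` annihilates `K`.
  refine free_of_injective_lTensor_socle hN (injective_lTensor_socle_of_injective
    (g := proj i) (c := applyₗ (Pi.single i 1)) (by simp) ?_ ?_ hker)
  · rw [mem_ker]
    refine LinearMap.ext fun v => ?_
    change socle R * d v i = 0
    rw [mul_comm, mul_socle_eq_zero_iff]
    exact hmin _ (d₀ v).2 i
  · intro v hv
    rw [mem_ker] at hv
    have hx : socle R • (Pi.single i 1 : Fin n → ResidueIdealization R) ∈ ker p := by
      rw [mem_ker, map_smul]
      exact Subtype.ext (hK _ (p _).2)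
    obtain ⟨w, hw⟩ := hd₀ ⟨_, hx⟩
    have hw' : d w = _ := congrArg Subtype.val hw
    have := LinearMap.congr_fun hv w
    rw [dualMap_apply, hw', map_smul, smul_eq_mul, mul_comm] at this
    exact mul_socle_eq_zero_iff.1 this

/-- A free module annihilated by `(0, 1)` vanishes. -/
lemma subsingleton_of_socle_smul_eq_zero {K : Type*} [AddCommGroup K]
    [Module (ResidueIdealization R) K] [Module.Free (ResidueIdealization R) K]
    (h : ∀ v : K, socle R • v = 0) : Subsingleton K := by
  by_contra hK
  rw [not_subsingleton_iff_nontrivial] at hK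
  let b := Module.Free.chooseBasis (ResidueIdealization R) K
  obtain ⟨i⟩ := b.index_nonempty
  have := congrArg (fun v => b.repr v i) (h (b i))
  have : (socle R).snd = 0 := by simpa using congrArg snd this
  exact one_ne_zero this

/-- If the syzygy `ker f` of `M` is free and annihilated by `(0, 1)`, then it vanishes and `M` is
free. -/
lemma free_of_free_ker {F M : Type*} [AddCommGroup F] [AddCommGroup M]
    [Module (ResidueIdealization R) F] [Module (ResidueIdealization R) M]
    [Module.Free (ResidueIdealization R) F] {f : F →ₗ[ResidueIdealization R] M}
    (hf : Function.Surjective f) (hK : ∀ v ∈ ker f, socle R • v = 0)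
    (h : Module.Free (ResidueIdealization R) (ker f)) :
    Module.Free (ResidueIdealization R) M := by
  have : Subsingleton (ker f) :=
    subsingleton_of_socle_smul_eq_zero (R := R) fun v => Subtype.ext (hK v v.2)
  refine Module.Free.of_equiv (LinearEquiv.ofBijective f ⟨?_, hf⟩)
  rwa [← ker_eq_bot, ← Submodule.subsingleton_iff_eq_bot]

lemma exists_socle_smul_minimal_cover (M : Type*) [AddCommGroup M]
    [Module (ResidueIdealization R) M] [Module.Finite (ResidueIdealization R) M] :
    ∃ (n : ℕ) (f : (Fin n → ResidueIdealization R) →ₗ[ResidueIdealization R] M),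
      Function.Surjective f ∧ ∀ v ∈ LinearMap.ker f, socle R • v = 0 := by
  obtain ⟨n, f, hf, hmin⟩ := exists_minimal_cover (ResidueIdealization R) M
  refine ⟨n, f, hf, fun v hv => funext fun i => ?_⟩
  rw [Pi.smul_apply, smul_eq_mul, mul_comm]
  exact mul_socle_eq_zero_iff.2 (hmin v hv i)

end ResidueIdealization

open ResidueIdealization in
theorem theorem3p3 (R : Type u) [CommRing R] [IsNoetherianRing R] [IsLocalRing R]
    (M N : Type u) [AddCommGroup M] [AddCommGroup N]
    [Module (ResidueIdealization R) M] [Module (ResidueIdealization R) N]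
    [Module.Finite (ResidueIdealization R) M] [Module.Finite (ResidueIdealization R) N]
    (hN : IsTorRigid (ResidueIdealization R) N) (i : ℕ) (hi : 0 < i)
    (hExt : Subsingleton (Abelian.Ext (ModuleCat.of (ResidueIdealization R) M)
      (ModuleCat.of (ResidueIdealization R) N) i)) :
    Module.Free (ResidueIdealization R) M ∨ Module.Free (ResidueIdealization R) N := by
  obtain ⟨i, rfl⟩ := Nat.exists_eq_succ_of_ne_zero hi.ne'
  induction i generalizing M with
  | zero =>
    obtain ⟨n, f, hf, hmin⟩ := exists_socle_smul_minimal_cover (R := R) M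
    rcases subsingleton_or_nontrivial (LinearMap.ker f) with h | h
    · exact .inl (free_of_free_ker hf hmin inferInstance)
    · exact .inr (free_of_forall_exists_extension hN hmin
        (exists_extension_of_subsingleton_ext_one N hf hExt))
  | succ i ih =>
    obtain ⟨n, f, hf, hmin⟩ := exists_socle_smul_minimal_cover (R := R) M
    exact (ih (LinearMap.ker f) i.succ_pos (subsingleton_ext_ker N hf i hExt)).imp_left
      (free_of_free_ker hf hmin)
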